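/- Definitions. A $k$-distinguisher on a vertex set $\mathcal V$ is an undirected $k$-hypergraph $g$, that is, a set $E_g\subseteq\mathcal V^k$ of $k$-tuples that is invariant under permutations of the coordinates (tuples with repeated entries are allowed; for $k=1$ it is a subset of $\mathcal V$, for $k=2$ a graph in which self-loops are allowed). A $k$-distinguishing class is a set of $k$-distinguishers on $\mathcal V$. For a probability distribution $P$ on $\mathcal V$ put $L_P(g)=P^k(E_g)$, and for a class $\mathcal G$ put $\mathrm{IPM}_{\mathcal G}(p_1,p_2)=\sup_{g\in\mathcal G}|L_{p_1}(g)-L_{p_2}(g)|$. The VC dimension of a $1$-distinguishing class $\mathcal D$ is the supremum of the sizes of the finite sets $S\subseteq\mathcal V$ all of whose subsets are of the form $S\cap d$ with $d\in\mathcal D$. A $\mathcal G$-discriminating algorithm with sample complexity $m(\epsilon,\delta)$ maps any pair of finite samples of vertices to an element of $\mathcal G$ so that, for all $\epsilon>0$, all $\delta\in(0,1)$ and all distributions $p_1,p_2$ on $\mathcal V$: if $S_1,S_2$ are independent i.i.d. samples from $p_1,p_2$ with $|S_1|,|S_2|>m(\epsilon,\delta)$, then with probability at least $1-\delta$ the output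 $g$ satisfies $|L_{p_1}(g)-L_{p_2}(g)|>\mathrm{IPM}_{\mathcal G}(p_1,p_2)-\epsilon$. A class has sample complexity $m$ if it has such an algorithm. Theorem. Let $\mathcal V=\mathbb N$. There is an absolute constant $C>0$ such that the following hold. (1) There is a single graph $g$ on $\mathcal V$ such that the class $\{g\}$ has sample complexity $C\log(1/\delta)/\epsilon^2$ and, for every $1$-distinguishing class $\mathcal D$ of finite VC dimension and every $\epsilon>0$, there are distributions $p_1,p_2$ on $\mathcal V$ with $\mathrm{IPM}_{\mathcal D}(p_1,p_2)<\epsilon$ and $\mathrm{IPM}_{\{g\}}(p_1,p_2)>\tfrac12$. (2) Let the elements of $\mathcal V$ be listed, by any bijection, as $v_i$ ($i\in\mathbb N$) and $v_A$ ($A\subset\mathbb N$ finite), and let $g$ be the bipartite graph whose edges join $v_i$ and $v_A$ exactly when $i\in A$. Then the class $\{g\}$ has sample complexity $C\log(1/\delta)/\epsilon^2$ and, for every $1$-distinguishing class $\mathcal D$ of finite VC dimension and every $\epsilon>0$, there are distributions $p_1,p_2$ on $\mathcal V$ with $\mathrm{IPM}_{\mathcal D}(p_1,p_2)<\epsilon$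 and $\mathrm{IPM}_{\{g\}}(p_1,p_2)\ge\tfrac12$. -/

import Mathlib

open MeasureTheory

namespace GraphDiscriminator

/-- A `k`-distinguisher on the vertex set `V`: an undirected `k`-hypergraph, given by its set of
hyperedges, which are `k`-tuples of vertices, closed under permutation of the coordinates
(tuples with repeated vertices, such as self-loops, are allowed). -/
@[ext]
structure Distinguisher (V : Type*) (k : ℕ) where
  /-- the set of hyperedges -/
  edges : Set (Fin k → V)
  /-- the hypergraph is undirected -/
  undirected : ∀ (π : Equiv.Perm (Fin k)) (v : Fin k → V), v ∘ π ∈ edges ↔ v ∈ edges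

/-- The frequency `L_P(g) = P^k(E_g)` of an edge of `g` under the distribution `P`. -/
noncomputable def edgeFreq {V : Type*} [MeasurableSpace V] {k : ℕ}
    (P : ProbabilityMeasure V) (g : Distinguisher V k) : ℝ :=
  (Measure.pi fun _ : Fin k => (P : Measure V)).real g.edges

/-- The IPM distance `sup_{g ∈ G} |L_{p₁}(g) - L_{p₂}(g)|` of a `k`-distinguishing class `G`.
The supremum is over reals in `[0, 1]`; it is `0` for the empty class. -/
noncomputable def IPM {V : Type*} [MeasurableSpace V] {k : ℕ}
    (G : Set (Distinguisher V k)) (p₁ p₂ : ProbabilityMeasure V) : ℝ :=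
  ⨆ g : G, |edgeFreq p₁ (g : Distinguisher V k) - edgeFreq p₂ (g : Distinguisher V k)|

/-- The finite vertex set `S` is shattered by the `1`-distinguishing class `D`: every subset of `S`
is the trace on `S` of a member of `D`. -/
def Shatters {V : Type*} (D : Set (Distinguisher V 1)) (S : Finset V) : Prop :=
  ∀ T ⊆ S, ∃ d ∈ D, ∀ v ∈ S, (fun _ => v) ∈ d.edges ↔ v ∈ T

/-- The VC dimension of a `1`-distinguishing class: the supremum of the sizes of shattered sets. -/
noncomputable def vcDim {V : Type*} (D : Set (Distinguisher V 1)) : ℕ∞ :=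
  ⨆ S : {S : Finset V // Shatters D S}, ((S : Finset V).card : ℕ∞)

/-- `A` is a `G`-discriminating algorithm with sample complexity `m ε δ`: from any two finite
samples it outputs a member of `G` and, when the samples are drawn independently and identically
from unknown distributions `p₁`, `p₂` and have more than `m ε δ` points each, then with probability
at least `1 - δ` the output `g` satisfies `|L_{p₁}(g) - L_{p₂}(g)| > IPM_G(p₁, p₂) - ε`. -/
def IsDiscriminatingAlgorithm {V : Type*} [MeasurableSpace V] {k : ℕ}
    (G : Set (Distinguisher V k))
    (A : (n₁ n₂ : ℕ) → (Fin n₁ → V) → (Fin n₂ → V) → Distinguisher V k)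
    (m : ℝ → ℝ → ℝ) : Prop :=
  (∀ n₁ n₂ S₁ S₂, A n₁ n₂ S₁ S₂ ∈ G) ∧
  ∀ ε δ : ℝ, 0 < ε → 0 < δ → δ < 1 →
    ∀ (p₁ p₂ : ProbabilityMeasure V) (n₁ n₂ : ℕ), m ε δ < n₁ → m ε δ < n₂ →
      1 - δ ≤ ((Measure.pi fun _ : Fin n₁ => (p₁ : Measure V)).prod
          (Measure.pi fun _ : Fin n₂ => (p₂ : Measure V))).real
        {S | IPM G p₁ p₂ - ε <
          |edgeFreq p₁ (A n₁ n₂ S.1 S.2) - edgeFreq p₂ (A n₁ n₂ S.1 S.2)|}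

/-- The class `G` has sample complexity at most `m`: some `G`-discriminating algorithm has sample
complexity `m`. -/
def HasSampleComplexity {V : Type*} [MeasurableSpace V] {k : ℕ}
    (G : Set (Distinguisher V k)) (m : ℝ → ℝ → ℝ) : Prop :=
  ∃ A, IsDiscriminatingAlgorithm G A m

/-- The bipartite graph of the membership relation. The bijection `e` splits the vertices into the
vertices `v_i = e.symm (inl i)`, for `i : ℕ`, and the vertices `v_A = e.symm (inr A)`, for the
finite sets `A` of natural numbers; `v_i` and `v_A` are joined iff `i ∈ A`, and there are no other
edges. -/
def membershipGraph {V : Type*} (e : V ≃ ℕ ⊕ Finset ℕ) : Distinguisher V 2 where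
  edges := {v | ∃ (i : ℕ) (A : Finset ℕ) (σ : Equiv.Perm (Fin 2)), i ∈ A ∧
    v (σ 0) = e.symm (Sum.inl i) ∧ v (σ 1) = e.symm (Sum.inr A)}
  undirected := by
    intro π v
    constructor
    · rintro ⟨i, A, σ, h, h0, h1⟩
      exact ⟨i, A, π * σ, h, h0, h1⟩
    · rintro ⟨i, A, σ, h, h0, h1⟩
      exact ⟨i, A, π⁻¹ * σ, h, by simpa using h0, by simpa using h1⟩

end GraphDiscriminator

open GraphDiscriminator

/-!
Since `{g}` offers the algorithm no choice, the sample complexity is no obstacle, and everything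
lies in the distributions. Take many disjoint pairs of vertices. By Sauer–Shelah, a class of finite
VC dimension has only polynomially many traces on them, so by Hoeffding's inequality and a union
bound some choice of one vertex from each pair is nearly balanced, in every trace, against the
complementary choice: the uniform distributions on the two choices are close for the class.

The graph is fixed before these choices, but it can be rich enough to tell any two disjoint finite
sets of vertices apart. In the membership graph, half of the mass is moved to the vertex `v_A`,
where `A` is the first choice. In a graph with the extension property the construction is iterated:
each new family of pairs is taken among the vertices joined to all of the first support and to none
of the second support built so far, so that the first distribution becomes nearly complete
multipartite and the second nearly edgeless.
-/

namespace GraphDiscriminator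

open Filter Set unitInterval

section RandomSigns

variable {ι : Type*} [Fintype ι]

lemma sum_signs_exp [DecidableEq ι] (a : ι → ℝ) :
    ∑ s : ι → ℤˣ, Real.exp (∑ i, (s i : ℝ) * a i) = 2 ^ Fintype.card ι * ∏ i, Real.cosh (a i) := by
  have exp_add_exp_neg (i : ι) :
      ∑ b : ℤˣ, Real.exp ((b : ℝ) * a i) = 2 * Real.cosh (a i) := by
    rw [UnitsInt.univ, Finset.sum_pair (by decide), Real.cosh_eq]
    push_cast
    ring_nf
  simp only [Real.exp_sum]
  rw [← Fintype.piFinset_univ,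
    ← Finset.prod_univ_sum (fun _ ↦ Finset.univ) fun i (b : ℤˣ) ↦ Real.exp ((b : ℝ) * a i)]
  simp only [exp_add_exp_neg, Finset.prod_mul_distrib, Finset.prod_const, Finset.card_univ]

lemma sum_signs_exp_le [DecidableEq ι] (a : ι → ℝ) :
    ∑ s : ι → ℤˣ, Real.exp (∑ i, (s i : ℝ) * a i) ≤
      2 ^ Fintype.card ι * Real.exp ((∑ i, a i ^ 2) / 2) := by
  rw [sum_signs_exp, Finset.sum_div, Real.exp_sum]
  gcongr with i
  exact Real.cosh_le_exp_half_sq (a i)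

lemma sum_signs_exp_abs_le [DecidableEq ι] (a : ι → ℝ) :
    ∑ s : ι → ℤˣ, Real.exp |∑ i, (s i : ℝ) * a i| ≤
      2 ^ Fintype.card ι * (2 * Real.exp ((∑ i, a i ^ 2) / 2)) := by
  calc ∑ s : ι → ℤˣ, Real.exp |∑ i, (s i : ℝ) * a i|
      ≤ ∑ s : ι → ℤˣ,
          (Real.exp (∑ i, (s i : ℝ) * a i) + Real.exp (∑ i, (s i : ℝ) * (-a) i)) := by
        gcongr with s
        simpa only [Pi.neg_apply, mul_neg, Finset.sum_neg_distrib] using Real.exp_abs_le _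
    _ ≤ 2 ^ Fintype.card ι * Real.exp ((∑ i, a i ^ 2) / 2) +
          2 ^ Fintype.card ι * Real.exp ((∑ i, (-a) i ^ 2) / 2) := by
        rw [Finset.sum_add_distrib]
        gcongr <;> exact sum_signs_exp_le _
    _ = 2 ^ Fintype.card ι * (2 * Real.exp ((∑ i, a i ^ 2) / 2)) := by
        simp only [Pi.neg_apply, neg_sq]
        ring

/-- A union bound over Hoeffding's inequality. -/
theorem exists_signs_forall_abs_sum_lt {κ : Type*} {K : Finset κ} {a : κ → ι → ℝ}
    (ha : ∀ k ∈ K, ∀ i, |a k i| ≤ 1) {c : ℝ} (hc : 0 < c)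
    (hK : 2 * (K.card : ℝ) < Real.exp (c ^ 2 / 2 * Fintype.card ι)) :
    ∃ s : ι → ℤˣ, ∀ k ∈ K, |∑ i, (s i : ℝ) * a k i| < c * Fintype.card ι := by
  classical
  set N : ℝ := (Fintype.card ι : ℝ)
  have moment_le (k : κ) (hk : k ∈ K) :
      ∑ s : ι → ℤˣ, Real.exp |∑ i, (s i : ℝ) * (c * a k i)| ≤
        2 ^ Fintype.card ι * (2 * Real.exp (c ^ 2 / 2 * N)) := by
    refine (sum_signs_exp_abs_le _).trans ?_
    have sum_sq_le : ∑ i, (c * a k i) ^ 2 ≤ c ^ 2 * N := by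
      calc ∑ i, (c * a k i) ^ 2 ≤ ∑ _i : ι, c ^ 2 := Finset.sum_le_sum fun i _ ↦ by
            rw [mul_pow]
            exact mul_le_of_le_one_right (sq_nonneg c) ((sq_le_one_iff_abs_le_one _).2 (ha k hk i))
        _ = c ^ 2 * N := by simp [N, mul_comm]
    gcongr
    linarith
  have total_lt :
      ∑ s : ι → ℤˣ, ∑ k ∈ K, Real.exp |∑ i, (s i : ℝ) * (c * a k i)| <
        ∑ _s : ι → ℤˣ, Real.exp (c * (c * N)) := by
    rw [Finset.sum_comm]
    calc ∑ k ∈ K, ∑ s : ι → ℤˣ, Real.exp |∑ i, (s i : ℝ) * (c * a k i)|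
        ≤ ∑ _k ∈ K, 2 ^ Fintype.card ι * (2 * Real.exp (c ^ 2 / 2 * N)) :=
          Finset.sum_le_sum moment_le
      _ = 2 ^ Fintype.card ι * (2 * (K.card : ℝ) * Real.exp (c ^ 2 / 2 * N)) := by
          rw [Finset.sum_const, nsmul_eq_mul]
          ring
      _ < 2 ^ Fintype.card ι * (Real.exp (c ^ 2 / 2 * N) * Real.exp (c ^ 2 / 2 * N)) := by
          gcongr
      _ = ∑ _s : ι → ℤˣ, Real.exp (c * (c * N)) := by
          rw [← Real.exp_add, Finset.sum_const, Finset.card_univ, Fintype.card_fun,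
            Fintype.card_units_int, nsmul_eq_mul]
          push_cast
          ring_nf
  obtain ⟨s, -, hs⟩ := Finset.exists_lt_of_sum_lt total_lt
  refine ⟨s, fun k hk ↦ ?_⟩
  have exp_lt : Real.exp |∑ i, (s i : ℝ) * (c * a k i)| < Real.exp (c * (c * N)) :=
    (Finset.single_le_sum (f := fun k ↦ Real.exp |∑ i, (s i : ℝ) * (c * a k i)|)
      (fun _ _ ↦ (Real.exp_pos _).le) hk).trans_lt hs
  have abs_eq : |∑ i, (s i : ℝ) * (c * a k i)| = c * |∑ i, (s i : ℝ) * a k i| := by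
    simp only [mul_left_comm _ c, ← Finset.mul_sum, abs_mul, abs_of_pos hc]
  rw [Real.exp_lt_exp, abs_eq] at exp_lt
  exact lt_of_mul_lt_mul_left exp_lt hc.le

end RandomSigns

section Traces

variable {V ι : Type*} [Fintype ι] {D : Set (Distinguisher V 1)}

/-- A `1`-distinguisher as a set of vertices. -/
def Distinguisher.vertexSet (d : Distinguisher V 1) : Set V := {v | (fun _ ↦ v) ∈ d.edges}

lemma Shatters.card_le_vcDim {S : Finset V} (hS : Shatters D S) : (S.card : ℕ∞) ≤ vcDim D :=
  le_iSup (fun S : {S : Finset V // Shatters D S} ↦ ((S : Finset V).card : ℕ∞)) ⟨S, hS⟩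

open Classical in
/-- The traces of the class `D` on the family of vertices `u`, as sets of indices, so that the
set-family form of the Sauer–Shelah lemma applies to them. -/
noncomputable def traces (D : Set (Distinguisher V 1)) (u : ι → V) : Finset (Finset ι) :=
  {T | ∃ d ∈ D, (T : Set ι) = u ⁻¹' d.vertexSet}

lemma mem_traces {u : ι → V} {T : Finset ι} :
    T ∈ traces D u ↔ ∃ d ∈ D, (T : Set ι) = u ⁻¹' d.vertexSet := by
  simp [traces]

lemma exists_mem_traces {d : Distinguisher V 1} (hd : d ∈ D) (u : ι → V) :
    ∃ T ∈ traces D u, (T : Set ι) = u ⁻¹' d.vertexSet := by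
  classical
  exact ⟨(u ⁻¹' d.vertexSet).toFinset, mem_traces.2 ⟨d, hd, coe_toFinset _⟩, coe_toFinset _⟩

lemma Shatters.map_of_traces [DecidableEq ι] {u : ι ↪ V} {S : Finset ι}
    (hS : (traces D u).Shatters S) : Shatters D (S.map u) := by
  intro T hT
  obtain ⟨t, ht, rfl⟩ := Finset.subset_map_iff.1 hT
  obtain ⟨w, hw, rfl⟩ := hS ht
  obtain ⟨d, hd, hwd⟩ := mem_traces.1 hw
  refine ⟨d, hd, fun v hv ↦ ?_⟩
  obtain ⟨i, hi, rfl⟩ := Finset.mem_map.1 hv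
  rw [Finset.mem_map', Finset.mem_inter, and_iff_right hi, ← Finset.mem_coe, hwd]
  rfl

lemma card_traces_le [Nonempty ι] {r : ℕ} (hD : vcDim D ≤ r) (u : ι ↪ V) :
    (traces D u).card ≤ (r + 1) * Fintype.card ι ^ r := by
  classical
  have vcDim_le : (traces D u).vcDim ≤ r := Finset.sup_le fun S hS ↦ by
    have := (Shatters.map_of_traces (Finset.mem_shatterer.1 hS)).card_le_vcDim.trans hD
    rwa [Finset.card_map, Nat.cast_le] at this
  calc (traces D u).card
      ≤ ∑ k ∈ Finset.Iic (traces D u).vcDim, (Fintype.card ι).choose k :=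
        (Finset.card_le_card_shatterer _).trans Finset.card_shatterer_le_sum_vcDim
    _ ≤ ∑ k ∈ Finset.Iic r, (Fintype.card ι).choose k :=
        Finset.sum_le_sum_of_subset (Finset.Iic_subset_Iic.2 vcDim_le)
    _ ≤ ∑ _k ∈ Finset.Iic r, Fintype.card ι ^ r :=
        Finset.sum_le_sum fun k hk ↦ (Nat.choose_le_pow _ _).trans
          (Nat.pow_le_pow_right Fintype.card_pos (Finset.mem_Iic.1 hk))
    _ = (r + 1) * Fintype.card ι ^ r := by simp

lemma eventually_const_mul_pow_lt_exp (A : ℝ) (r : ℕ) {c : ℝ} (hc : 0 < c) :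
    ∀ᶠ n : ℕ in atTop, A * (n : ℝ) ^ r < Real.exp (c * n) := by
  have hlittle := ((isLittleO_pow_exp_pos_mul_atTop r hc).const_mul_left A).comp_tendsto
    tendsto_natCast_atTop_atTop
  filter_upwards [hlittle.bound (c := 1 / 2) (by norm_num)] with n hn
  simp only [Function.comp_apply, Real.norm_eq_abs, Real.abs_exp] at hn
  linarith [le_abs_self (A * (n : ℝ) ^ r), Real.exp_pos (c * n)]

lemma exists_forall_card_traces_lt_exp (hD : vcDim D < ⊤) {c : ℝ} (hc : 0 < c) :
    ∃ n : ℕ, ∀ u : Fin (n + 1) × ℤˣ ↪ V,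
      2 * ((traces D u).card : ℝ) < Real.exp (c * (n + 1 : ℕ)) := by
  obtain ⟨r, hr⟩ := ENat.ne_top_iff_exists.1 hD.ne
  obtain ⟨n, hn⟩ := ((tendsto_add_atTop_nat 1).eventually
    (eventually_const_mul_pow_lt_exp (2 * (r + 1) * 2 ^ r) r hc)).exists
  refine ⟨n, fun u ↦ lt_of_le_of_lt ?_ hn⟩
  have card_le : ((traces D u).card : ℝ) ≤ (r + 1) * ((n + 1 : ℕ) * 2) ^ r := by
    have := card_traces_le hr.ge u
    rw [Fintype.card_prod, Fintype.card_fin, Fintype.card_units_int] at this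
    exact_mod_cast this
  rw [mul_pow] at card_le
  linarith

end Traces

section Adjacency

variable {V : Type*} {g : Distinguisher V 2}

/-- Adjacency of two vertices, possibly equal, in a graph. -/
def Distinguisher.Adj (g : Distinguisher V 2) (x y : V) : Prop := ![x, y] ∈ g.edges

lemma perm_fin_two_eq (π : Equiv.Perm (Fin 2)) : π = 1 ∨ π = Equiv.swap 0 1 := by
  decide +revert

lemma Distinguisher.adj_comm {x y : V} : g.Adj x y ↔ g.Adj y x := by
  rw [Adj, Adj, ← g.undirected (Equiv.swap 0 1) ![y, x]]
  congr!
  ext i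
  fin_cases i <;> rfl

end Adjacency

section EdgeFrequency

variable {V : Type*} [MeasurableSpace V] {k : ℕ}

lemma edgeFreq_nonneg (P : ProbabilityMeasure V) (g : Distinguisher V k) : 0 ≤ edgeFreq P g :=
  measureReal_nonneg

lemma edgeFreq_le_one (P : ProbabilityMeasure V) (g : Distinguisher V k) : edgeFreq P g ≤ 1 :=
  measureReal_le_one

lemma abs_edgeFreq_sub_le_IPM {G : Set (Distinguisher V k)} {g : Distinguisher V k} (hg : g ∈ G)
    (P Q : ProbabilityMeasure V) : |edgeFreq P g - edgeFreq Q g| ≤ IPM G P Q := by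
  refine le_ciSup (f := fun g : G ↦ |edgeFreq P g.1 - edgeFreq Q g.1|) ⟨1, ?_⟩ ⟨g, hg⟩
  rintro _ ⟨g, rfl⟩
  exact abs_sub_le_of_nonneg_of_le (edgeFreq_nonneg _ _) (edgeFreq_le_one _ _)
    (edgeFreq_nonneg _ _) (edgeFreq_le_one _ _)

lemma IPM_nonneg (G : Set (Distinguisher V k)) (P Q : ProbabilityMeasure V) : 0 ≤ IPM G P Q :=
  Real.iSup_nonneg fun _ ↦ abs_nonneg _

lemma IPM_le {G : Set (Distinguisher V k)} {P Q : ProbabilityMeasure V} {ε : ℝ} (hε : 0 ≤ ε)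
    (h : ∀ g ∈ G, |edgeFreq P g - edgeFreq Q g| ≤ ε) : IPM G P Q ≤ ε :=
  Real.iSup_le (fun g ↦ h g g.2) hε

lemma IPM_self (G : Set (Distinguisher V k)) (P : ProbabilityMeasure V) : IPM G P P = 0 := by
  simp [IPM]

lemma IPM_singleton (g : Distinguisher V k) (P Q : ProbabilityMeasure V) :
    IPM {g} P Q = |edgeFreq P g - edgeFreq Q g| :=
  ciSup_unique

lemma hasSampleComplexity_singleton (g : Distinguisher V k) (m : ℝ → ℝ → ℝ) :
    HasSampleComplexity {g} m := by
  refine ⟨fun _ _ _ _ ↦ g, fun _ _ _ _ ↦ rfl, fun ε δ hε hδ _ P Q n₁ n₂ _ _ ↦ ?_⟩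
  simp [IPM_singleton, hε, hδ.le]

lemma edgeFreq_one (P : ProbabilityMeasure V) (d : Distinguisher V 1) :
    edgeFreq P d = (P : Measure V).real d.vertexSet := by
  have h := (measurePreserving_funUnique (P : Measure V) (Fin 1)).measure_preimage_equiv d.vertexSet
  rw [Measure.real, ← h, edgeFreq, Measure.real]
  congr 2
  ext v
  have : v = fun _ ↦ v 0 := funext fun i ↦ congrArg v (Subsingleton.elim i 0)
  rw [this]
  rfl

/-- The probability that two independent vertices, with distributions `P` and `Q`, are joined. -/
noncomputable def jointFreq (P Q : ProbabilityMeasure V) (g : Distinguisher V 2) : ℝ :=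
  ((P : Measure V).prod Q).real {x | g.Adj x.1 x.2}

lemma edgeFreq_two (P : ProbabilityMeasure V) (g : Distinguisher V 2) :
    edgeFreq P g = jointFreq P P g := by
  have h := (measurePreserving_finTwoArrow (P : Measure V)).measure_preimage_equiv
    {x | g.Adj x.1 x.2}
  rw [jointFreq, Measure.real, ← h, edgeFreq, Measure.real]
  congr 2
  ext v
  have : v = ![v 0, v 1] := by ext i; fin_cases i <;> rfl
  rw [this]
  rfl

lemma jointFreq_comm (P Q : ProbabilityMeasure V) (g : Distinguisher V 2) :
    jointFreq P Q g = jointFreq Q P g := by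
  have h := Measure.measurePreserving_swap (μ := (P : Measure V)) (ν := (Q : Measure V))
    |>.measure_preimage_emb MeasurableEquiv.prodComm.measurableEmbedding {x | g.Adj x.1 x.2}
  rw [jointFreq, jointFreq, Measure.real, Measure.real, ← h]
  congr 2
  ext x
  exact Distinguisher.adj_comm

section Support

variable {P Q : ProbabilityMeasure V} {g : Distinguisher V 2} {X Y : Set V}

lemma jointFreq_eq_one (hP : ∀ᵐ v ∂(P : Measure V), v ∈ X) (hQ : ∀ᵐ v ∂(Q : Measure V), v ∈ Y)
    (h : ∀ x ∈ X, ∀ y ∈ Y, g.Adj x y) : jointFreq P Q g = 1 := by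
  rw [jointFreq, measureReal_congr (t := univ), probReal_univ]
  filter_upwards [Measure.quasiMeasurePreserving_fst.ae hP,
    Measure.quasiMeasurePreserving_snd.ae hQ] with x hx hy
  exact eq_true (h _ hx _ hy)

lemma jointFreq_eq_zero (hP : ∀ᵐ v ∂(P : Measure V), v ∈ X) (hQ : ∀ᵐ v ∂(Q : Measure V), v ∈ Y)
    (h : ∀ x ∈ X, ∀ y ∈ Y, ¬ g.Adj x y) : jointFreq P Q g = 0 := by
  rw [jointFreq, measureReal_congr (t := ∅), measureReal_empty]
  filter_upwards [Measure.quasiMeasurePreserving_fst.ae hP,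
    Measure.quasiMeasurePreserving_snd.ae hQ] with x hx hy
  exact eq_false (h _ hx _ hy)

lemma edgeFreq_two_eq_zero (hP : ∀ᵐ v ∂(P : Measure V), v ∈ X)
    (h : ∀ x ∈ X, ∀ y ∈ X, ¬ g.Adj x y) : edgeFreq P g = 0 := by
  rw [edgeFreq_two, jointFreq_eq_zero hP hP h]

end Support

end EdgeFrequency

section Mixture

variable {V : Type*} [MeasurableSpace V]

/-- The mixture `t P + (1 - t) Q` of two distributions. -/
noncomputable def mix (t : I) (P Q : ProbabilityMeasure V) : ProbabilityMeasure V :=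
  ⟨toNNReal t • (P : Measure V) + toNNReal (σ t) • (Q : Measure V), inferInstance⟩

lemma toMeasure_mix (t : I) (P Q : ProbabilityMeasure V) :
    (mix t P Q : Measure V) = toNNReal t • (P : Measure V) + toNNReal (σ t) • (Q : Measure V) :=
  rfl

lemma ae_mem_mix {P Q : ProbabilityMeasure V} {X Y : Set V} (t : I)
    (hP : ∀ᵐ v ∂(P : Measure V), v ∈ X) (hQ : ∀ᵐ v ∂(Q : Measure V), v ∈ Y) :
    ∀ᵐ v ∂(mix t P Q : Measure V), v ∈ X ∪ Y := by
  rw [toMeasure_mix, ae_add_measure_iff]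
  exact ⟨Measure.ae_smul_measure (hP.mono fun _ ↦ .inl) _,
    Measure.ae_smul_measure (hQ.mono fun _ ↦ .inr) _⟩

lemma edgeFreq_one_mix (t : I) (P Q : ProbabilityMeasure V) (d : Distinguisher V 1) :
    edgeFreq (mix t P Q) d = t * edgeFreq P d + (1 - t) * edgeFreq Q d := by
  simp only [edgeFreq_one, toMeasure_mix]
  rw [measureReal_add_apply]
  simp

lemma edgeFreq_two_mix (t : I) (P Q : ProbabilityMeasure V) (g : Distinguisher V 2) :
    edgeFreq (mix t P Q) g = t ^ 2 * edgeFreq P g + 2 * t * (1 - t) * jointFreq P Q g +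
      (1 - t) ^ 2 * edgeFreq Q g := by
  have cross := jointFreq_comm P Q g
  simp only [edgeFreq_two, jointFreq, toMeasure_mix] at cross ⊢
  simp only [Measure.add_prod, Measure.prod_add, Measure.prod_smul_left, Measure.prod_smul_right]
  rw [measureReal_add_apply, measureReal_nnreal_smul_apply, measureReal_nnreal_smul_apply,
    measureReal_add_apply, measureReal_add_apply]
  simp only [measureReal_nnreal_smul_apply, coe_toNNReal, coe_symm_eq, ← cross]
  ring

lemma IPM_mix_le (D : Set (Distinguisher V 1)) (t : I) (P Q P' Q' : ProbabilityMeasure V) :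
    IPM D (mix t P P') (mix t Q Q') ≤ t * IPM D P Q + (1 - t) * IPM D P' Q' := by
  have ht : (0 : ℝ) ≤ t := t.2.1
  have ht' : (0 : ℝ) ≤ 1 - t := sub_nonneg.2 t.2.2
  refine IPM_le (add_nonneg (mul_nonneg ht (IPM_nonneg ..)) (mul_nonneg ht' (IPM_nonneg ..)))
    fun d hd ↦ ?_
  calc |edgeFreq (mix t P P') d - edgeFreq (mix t Q Q') d|
      = |t * (edgeFreq P d - edgeFreq Q d) + (1 - t) * (edgeFreq P' d - edgeFreq Q' d)| := by
        rw [edgeFreq_one_mix, edgeFreq_one_mix]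
        ring_nf
    _ ≤ t * |edgeFreq P d - edgeFreq Q d| + (1 - t) * |edgeFreq P' d - edgeFreq Q' d| := by
        refine (abs_add_le _ _).trans_eq ?_
        rw [abs_mul, abs_mul, abs_of_nonneg ht, abs_of_nonneg ht']
    _ ≤ t * IPM D P Q + (1 - t) * IPM D P' Q' := by
        gcongr <;> exact abs_edgeFreq_sub_le_IPM hd _ _

end Mixture

section Indistinguishability

variable {V : Type*} [MeasurableSpace V] {D : Set (Distinguisher V 1)} {ε : ℝ}

/-- `P` and `Q` have the disjoint finite supports `X` and `Y` and are at `D`-distance at most `ε`.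
The supports are kept as data, because further vertices are chosen relative to them. -/
structure AreIndistinguishable (D : Set (Distinguisher V 1)) (ε : ℝ) (P Q : ProbabilityMeasure V)
    (X Y : Set V) : Prop where
  finite_left : X.Finite
  finite_right : Y.Finite
  disjoint : Disjoint X Y
  ae_left : ∀ᵐ v ∂(P : Measure V), v ∈ X
  ae_right : ∀ᵐ v ∂(Q : Measure V), v ∈ Y
  IPM_le : IPM D P Q ≤ ε

lemma AreIndistinguishable.mix_union {P Q P' Q' : ProbabilityMeasure V} {X Y X' Y' : Set V}
    (h : AreIndistinguishable D ε P Q X Y) (h' : AreIndistinguishable D ε P' Q' X' Y')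
    (hdisj : Disjoint (X ∪ Y) (X' ∪ Y')) (t : I) :
    AreIndistinguishable D ε (mix t P P') (mix t Q Q') (X ∪ X') (Y ∪ Y') where
  finite_left := h.finite_left.union h'.finite_left
  finite_right := h.finite_right.union h'.finite_right
  disjoint := by
    simp only [disjoint_union_left, disjoint_union_right] at hdisj ⊢
    exact ⟨⟨h.disjoint, hdisj.1.2.symm⟩, hdisj.2.1, h'.disjoint⟩
  ae_left := ae_mem_mix t h.ae_left h'.ae_left
  ae_right := ae_mem_mix t h.ae_right h'.ae_right
  IPM_le := calc
    IPM D (mix t P P') (mix t Q Q') ≤ t * IPM D P Q + (1 - t) * IPM D P' Q' := IPM_mix_le ..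
    _ ≤ t * ε + (1 - t) * ε :=
      add_le_add (mul_le_mul_of_nonneg_left h.IPM_le t.2.1)
        (mul_le_mul_of_nonneg_left h'.IPM_le (sub_nonneg.2 t.2.2))
    _ = ε := by ring

/-- The distribution of a uniformly random member of a finite family of vertices. -/
noncomputable def empirical {ι : Type*} [Fintype ι] [Nonempty ι] (x : ι → V) :
    ProbabilityMeasure V :=
  ⟨(Fintype.card ι : ENNReal)⁻¹ • ∑ i, Measure.dirac (x i),
    ⟨by simp [ENNReal.inv_mul_cancel]⟩⟩

variable [MeasurableSingletonClass V]

lemma empirical_real {ι : Type*} [Fintype ι] [Nonempty ι] (x : ι → V) (S : Set V) :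
    (empirical x : Measure V).real S = (Fintype.card ι : ℝ)⁻¹ * ∑ i, S.indicator 1 (x i) := by
  have indicator_toReal (i : ι) : (S.indicator (1 : V → ENNReal) (x i)).toReal =
      S.indicator (1 : V → ℝ) (x i) := by
    by_cases hi : x i ∈ S <;> simp [hi]
  have indicator_ne_top (i : ι) : S.indicator (1 : V → ENNReal) (x i) ≠ ⊤ := by
    by_cases hi : x i ∈ S <;> simp [hi]
  simp [empirical, Measure.real, ENNReal.toReal_sum, indicator_toReal, indicator_ne_top]

lemma ae_mem_range_empirical {ι : Type*} [Fintype ι] [Nonempty ι] (x : ι → V) :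
    ∀ᵐ v ∂(empirical x : Measure V), v ∈ range x := by
  simp [empirical]

lemma exists_signs_IPM_empirical_le {ι : Type*} [Fintype ι] [Nonempty ι] (u : ι × ℤˣ → V)
    (hε : 0 < ε)
    (hcard : 2 * ((traces D u).card : ℝ) < Real.exp (ε ^ 2 / 2 * Fintype.card ι)) :
    ∃ s : ι → ℤˣ, IPM D (empirical fun i ↦ u (i, s i)) (empirical fun i ↦ u (i, -s i)) ≤ ε := by
  let a (T : Finset (ι × ℤˣ)) (i : ι) : ℝ :=
    (T : Set (ι × ℤˣ)).indicator 1 (i, 1) - (T : Set (ι × ℤˣ)).indicator 1 (i, -1)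
  have abs_a_le (T : Finset (ι × ℤˣ)) (i : ι) : |a T i| ≤ 1 := by
    by_cases h : (i, 1) ∈ T <;> by_cases h' : (i, -1) ∈ T <;> simp [a, h, h']
  obtain ⟨s, hs⟩ := exists_signs_forall_abs_sum_lt (fun T _ ↦ abs_a_le T) hε hcard
  refine ⟨s, IPM_le hε.le fun d hd ↦ ?_⟩
  obtain ⟨T, hT, hTd⟩ := exists_mem_traces hd u
  have indicator_sub (i : ι) : d.vertexSet.indicator (1 : V → ℝ) (u (i, s i)) -
      d.vertexSet.indicator 1 (u (i, -s i)) = s i * a T i := by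
    change (u ⁻¹' d.vertexSet).indicator 1 (i, s i) -
      (u ⁻¹' d.vertexSet).indicator 1 (i, -s i) = _
    rw [← hTd]
    obtain hi | hi := Int.units_eq_one_or (s i) <;> simp [hi, a]
  rw [edgeFreq_one, edgeFreq_one, empirical_real, empirical_real, ← mul_sub,
    ← Finset.sum_sub_distrib, abs_mul, abs_of_nonneg (by positivity),
    inv_mul_le_iff₀ (by exact_mod_cast Fintype.card_pos), mul_comm]
  simpa only [indicator_sub] using (hs T hT).le

theorem exists_areIndistinguishable_subset (hD : vcDim D < ⊤) (hε : 0 < ε) {W : Set V}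
    (hW : W.Infinite) :
    ∃ (P Q : ProbabilityMeasure V) (X Y : Set V),
      AreIndistinguishable D ε P Q X Y ∧ X ∪ Y ⊆ W := by
  obtain ⟨n, hn⟩ := exists_forall_card_traces_lt_exp hD (c := ε ^ 2 / 2) (by positivity)
  have : Infinite W := hW.to_subtype
  let f : Fin (n + 1) × ℤˣ ↪ W :=
    (Fintype.equivFin _).toEmbedding.trans (Fin.valEmbedding.trans (Infinite.natEmbedding W))
  let u : Fin (n + 1) × ℤˣ ↪ V := f.trans (.subtype _)
  obtain ⟨s, hs⟩ := exists_signs_IPM_empirical_le u hε (by rw [Fintype.card_fin]; exact hn u)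
  refine ⟨_, _, range fun i ↦ u (i, s i), range fun i ↦ u (i, -s i),
    ⟨finite_range _, finite_range _, ?_, ae_mem_range_empirical _, ae_mem_range_empirical _, hs⟩,
    ?_⟩
  · rw [disjoint_range_iff]
    intro i j hij
    obtain ⟨rfl, h⟩ := Prod.mk.inj (u.injective hij)
    exact units_ne_neg_self (s i) h
  · rw [union_subset_iff, range_subset_iff, range_subset_iff]
    exact ⟨fun i ↦ (f _).2, fun i ↦ (f _).2⟩

end Indistinguishability

section ExtensionProperty

variable {V : Type*}

/-- The extension property of the Rado graph, with infinitely many witnesses: any two disjoint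
finite sets of vertices are told apart, the first being joined and the second not, by infinitely
many vertices. -/
def HasExtensionProperty (g : Distinguisher V 2) : Prop :=
  ∀ F F' : Set V, F.Finite → F'.Finite → Disjoint F F' →
    {v | (∀ x ∈ F, g.Adj x v) ∧ ∀ x ∈ F', ¬ g.Adj x v}.Infinite

/-- The graph that joins `x` and `y` whenever one of them belongs to the finite set encoded by the
other. It plays the role of the Rado graph on an arbitrary infinite vertex set. -/
def codingGraph (φ : V ≃ Finset V) : Distinguisher V 2 where
  edges := {v | v 0 ∈ φ (v 1) ∨ v 1 ∈ φ (v 0)}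
  undirected π v := by
    obtain rfl | rfl := perm_fin_two_eq π <;> simp [or_comm]

lemma adj_codingGraph {φ : V ≃ Finset V} {x y : V} :
    (codingGraph φ).Adj x y ↔ x ∈ φ y ∨ y ∈ φ x :=
  Iff.rfl

lemma hasExtensionProperty_codingGraph [Infinite V] (φ : V ≃ Finset V) :
    HasExtensionProperty (codingGraph φ) := by
  classical
  intro F F' hF hF' hdisj
  lift F to Finset V using hF
  lift F' to Finset V using hF'
  let code (a : V) : V := φ.symm (insert a F)
  have code_injOn : InjOn code ((F ∪ F' : Finset V) : Set V)ᶜ := by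
    intro a ha b _ hab
    have ha' : a ∈ insert b F := φ.symm.injective hab ▸ Finset.mem_insert_self a F
    exact (Finset.mem_insert.1 ha').resolve_right fun h ↦ ha (by simp [h])
  have infinite_codes := ((F ∪ F').finite_toSet.infinite_compl.image code_injOn).sdiff
    (F'.biUnion φ).finite_toSet
  refine infinite_codes.mono ?_
  rintro _ ⟨⟨a, ha, rfl⟩, hnot⟩
  refine ⟨fun x hx ↦ .inl (by simp [code, Finset.mem_coe.1 hx]), fun x hx hadj ↦ ?_⟩
  obtain h | h := adj_codingGraph.1 hadj
  · rw [Equiv.apply_symm_apply, Finset.mem_insert] at h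
    obtain rfl | hxF := h
    · exact ha (by simp_all)
    · exact disjoint_left.1 hdisj hxF hx
  · exact hnot (Finset.mem_biUnion.2 ⟨x, hx, h⟩)

lemma exists_hasExtensionProperty (V : Type*) [Infinite V] :
    ∃ g : Distinguisher V 2, HasExtensionProperty g :=
  have ⟨φ⟩ := Cardinal.eq.1 (Cardinal.mk_finset_of_infinite V).symm
  ⟨codingGraph φ, hasExtensionProperty_codingGraph φ⟩

variable [MeasurableSpace V] [MeasurableSingletonClass V] {D : Set (Distinguisher V 1)} {ε : ℝ}
  {g : Distinguisher V 2}

theorem HasExtensionProperty.exists_areIndistinguishable (hg : HasExtensionProperty g)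
    (hD : vcDim D < ⊤) (hε : 0 < ε) (n : ℕ) :
    ∃ (P Q : ProbabilityMeasure V) (X Y : Set V), AreIndistinguishable D ε P Q X Y ∧
      1 - 1 / (n + 1 : ℝ) ≤ edgeFreq P g ∧ edgeFreq Q g ≤ 1 / (n + 1 : ℝ) := by
  induction n with
  | zero =>
    obtain ⟨P, Q, X, Y, h, -⟩ := exists_areIndistinguishable_subset hD hε
      (hg ∅ ∅ finite_empty finite_empty (disjoint_empty ∅))
    exact ⟨P, Q, X, Y, h, by simpa using edgeFreq_nonneg P g, by simpa using edgeFreq_le_one Q g⟩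
  | succ n ih =>
    obtain ⟨P, Q, X, Y, h, hP, hQ⟩ := ih
    obtain ⟨P', Q', X', Y', h', hsub⟩ := exists_areIndistinguishable_subset hD hε
      ((hg X Y h.finite_left h.finite_right h.disjoint).sdiff
        (h.finite_left.union h.finite_right))
    have joint_one : jointFreq P P' g = 1 := jointFreq_eq_one h.ae_left h'.ae_left
      fun x hx y hy ↦ (hsub (.inl hy)).1.1 x hx
    have joint_zero : jointFreq Q Q' g = 0 := jointFreq_eq_zero h.ae_right h'.ae_right
      fun x hx y hy ↦ (hsub (.inr hy)).1.2 x hx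
    have hdisj : Disjoint (X ∪ Y) (X' ∪ Y') := disjoint_right.2 fun v hv ↦ (hsub hv).2
    -- this weight keeps all the families of vertices chosen so far equally likely
    let t : I := ⟨(n + 1) / (n + 2), by positivity, (div_le_one (by positivity)).2 (by linarith)⟩
    refine ⟨_, _, _, _, h.mix_union h' hdisj t, ?_, ?_⟩
    · calc 1 - 1 / ((n + 1 : ℕ) + 1 : ℝ)
          = t ^ 2 * (1 - 1 / (n + 1)) + 2 * t * (1 - t) * 1 + (1 - t) ^ 2 * 0 := by
            simp only [t]
            push_cast
            field_simp
            ring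
        _ ≤ edgeFreq (mix t P P') g := by
            rw [edgeFreq_two_mix, joint_one]
            gcongr
            exact edgeFreq_nonneg _ _
    · calc edgeFreq (mix t Q Q') g
          ≤ t ^ 2 * (1 / (n + 1)) + 2 * t * (1 - t) * 0 + (1 - t) ^ 2 * 1 := by
            rw [edgeFreq_two_mix, joint_zero]
            gcongr
            exact edgeFreq_le_one _ _
        _ = 1 / ((n + 1 : ℕ) + 1 : ℝ) := by
            simp only [t]
            push_cast
            field_simp
            ring

end ExtensionProperty

section MembershipGraph

variable {V : Type*} (e : V ≃ ℕ ⊕ Finset ℕ)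

lemma adj_membershipGraph_iff {x y : V} :
    (membershipGraph e).Adj x y ↔ ∃ (i : ℕ) (A : Finset ℕ), i ∈ A ∧
      (e x = .inl i ∧ e y = .inr A ∨ e y = .inl i ∧ e x = .inr A) := by
  simp only [← Equiv.eq_symm_apply]
  constructor
  · rintro ⟨i, A, π, hi, h0, h1⟩
    obtain rfl | rfl := perm_fin_two_eq π
    · exact ⟨i, A, hi, .inl ⟨h0, h1⟩⟩
    · exact ⟨i, A, hi, .inr ⟨h0, h1⟩⟩
  · rintro ⟨i, A, hi, ⟨hx, hy⟩ | ⟨hy, hx⟩⟩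
    · exact ⟨i, A, 1, hi, hx, hy⟩
    · exact ⟨i, A, Equiv.swap 0 1, hi, hy, hx⟩

lemma adj_membershipGraph_inl_inr {i : ℕ} {A : Finset ℕ} :
    (membershipGraph e).Adj (e.symm (.inl i)) (e.symm (.inr A)) ↔ i ∈ A := by
  simp [adj_membershipGraph_iff]

lemma not_adj_membershipGraph_inl_inl (i j : ℕ) :
    ¬ (membershipGraph e).Adj (e.symm (.inl i)) (e.symm (.inl j)) := by
  simp [adj_membershipGraph_iff]

lemma not_adj_membershipGraph_inr_inr (A B : Finset ℕ) :
    ¬ (membershipGraph e).Adj (e.symm (.inr A)) (e.symm (.inr B)) := by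
  simp [adj_membershipGraph_iff]

lemma exists_forall_adj_membershipGraph_iff {X : Set V} (hX : X.Finite) :
    ∃ A : Finset ℕ, ∀ i : ℕ,
      (membershipGraph e).Adj (e.symm (.inl i)) (e.symm (.inr A)) ↔ e.symm (.inl i) ∈ X := by
  have finite_preimage := hX.preimage (e.symm.injective.comp Sum.inl_injective).injOn
  exact ⟨finite_preimage.toFinset,
    fun i ↦ (adj_membershipGraph_inl_inr e).trans finite_preimage.mem_toFinset⟩

theorem exists_IPM_le_membershipGraph [MeasurableSpace V] [MeasurableSingletonClass V]
    {D : Set (Distinguisher V 1)} (hD : vcDim D < ⊤) {ε : ℝ} (hε : 0 < ε) :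
    ∃ P Q : ProbabilityMeasure V, IPM D P Q ≤ ε ∧ 1 / 2 ≤ edgeFreq P (membershipGraph e) ∧
      edgeFreq Q (membershipGraph e) = 0 := by
  obtain ⟨P, Q, X, Y, h, hsub⟩ := exists_areIndistinguishable_subset hD hε
    (infinite_range_of_injective (e.symm.injective.comp Sum.inl_injective))
  rw [union_subset_iff] at hsub
  obtain ⟨A, hA⟩ := exists_forall_adj_membershipGraph_iff e h.finite_left
  let w : V := e.symm (.inr A)
  let R : ProbabilityMeasure V := diracProba w
  have hR : ∀ᵐ v ∂(R : Measure V), v ∈ ({w} : Set V) :=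
    (ae_dirac_iff (measurableSet_singleton w)).2 rfl
  have joint_one : jointFreq P R (membershipGraph e) = 1 := by
    refine jointFreq_eq_one h.ae_left hR ?_
    rintro x hx _ rfl
    obtain ⟨i, rfl⟩ := hsub.1 hx
    exact (hA i).2 hx
  have joint_zero : jointFreq Q R (membershipGraph e) = 0 := by
    refine jointFreq_eq_zero h.ae_right hR ?_
    rintro x hx _ rfl hadj
    obtain ⟨i, rfl⟩ := hsub.2 hx
    exact disjoint_left.1 h.disjoint ((hA i).1 hadj) hx
  have freq_right : edgeFreq Q (membershipGraph e) = 0 := by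
    refine edgeFreq_two_eq_zero h.ae_right fun x hx y hy ↦ ?_
    obtain ⟨i, rfl⟩ := hsub.2 hx
    obtain ⟨j, rfl⟩ := hsub.2 hy
    exact not_adj_membershipGraph_inl_inl e i j
  have freq_dirac : edgeFreq R (membershipGraph e) = 0 := by
    refine edgeFreq_two_eq_zero hR ?_
    rintro _ rfl _ rfl
    exact not_adj_membershipGraph_inr_inr e A A
  let half : I := ⟨1 / 2, by norm_num, by norm_num⟩
  refine ⟨mix half P R, mix half Q R, (IPM_mix_le ..).trans ?_, ?_, ?_⟩
  · rw [IPM_self]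
    simp only [half]
    linarith [h.IPM_le]
  · rw [edgeFreq_two_mix, joint_one, freq_dirac]
    simp only [half]
    linarith [edgeFreq_nonneg P (membershipGraph e)]
  · rw [edgeFreq_two_mix, joint_zero, freq_right, freq_dirac]
    ring

end MembershipGraph

theorem mainTheorem3_general (V : Type*) [Infinite V] [MeasurableSpace V]
    [MeasurableSingletonClass V] :
    (∃ g : Distinguisher V 2, (∀ m : ℝ → ℝ → ℝ, HasSampleComplexity {g} m) ∧
      ∀ D : Set (Distinguisher V 1), vcDim D < ⊤ → ∀ ε : ℝ, 0 < ε → ∀ c : ℝ, c < 1 →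
        ∃ p₁ p₂ : ProbabilityMeasure V, IPM D p₁ p₂ < ε ∧ c < IPM {g} p₁ p₂) ∧
    ∀ e : V ≃ ℕ ⊕ Finset ℕ, (∀ m : ℝ → ℝ → ℝ, HasSampleComplexity {membershipGraph e} m) ∧
      ∀ D : Set (Distinguisher V 1), vcDim D < ⊤ → ∀ ε : ℝ, 0 < ε →
        ∃ p₁ p₂ : ProbabilityMeasure V,
          IPM D p₁ p₂ < ε ∧ 1 / 2 ≤ IPM {membershipGraph e} p₁ p₂ := by
  obtain ⟨g, hg⟩ := exists_hasExtensionProperty V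
  refine ⟨⟨g, hasSampleComplexity_singleton g, fun D hD ε hε c hc ↦ ?_⟩,
    fun e ↦ ⟨hasSampleComplexity_singleton _, fun D hD ε hε ↦ ?_⟩⟩
  · obtain ⟨n, hn⟩ := exists_nat_one_div_lt (half_pos (sub_pos.2 hc))
    obtain ⟨P, Q, X, Y, h, hP, hQ⟩ := hg.exists_areIndistinguishable hD (half_pos hε) n
    refine ⟨P, Q, h.IPM_le.trans_lt (half_lt_self hε), ?_⟩
    rw [IPM_singleton]
    exact (by linarith : c < _).trans_le (le_abs_self _)
  · obtain ⟨P, Q, h, hP, hQ⟩ := exists_IPM_le_membershipGraph e hD (half_pos hε)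
    refine ⟨P, Q, h.trans_lt (half_lt_self hε), ?_⟩
    rw [IPM_singleton, hQ, sub_zero]
    exact hP.trans (le_abs_self _)

end GraphDiscriminator

theorem mainTheorem3 :
    ∃ C : ℝ, 0 < C ∧
      (∃ g : Distinguisher ℕ 2,
        HasSampleComplexity {g} (fun ε δ => C * (Real.log (1 / δ) / ε ^ 2)) ∧
        ∀ D : Set (Distinguisher ℕ 1), vcDim D < ⊤ → ∀ ε : ℝ, 0 < ε →
          ∃ p₁ p₂ : MeasureTheory.ProbabilityMeasure ℕ,
            IPM D p₁ p₂ < ε ∧ 1 / 2 < IPM {g} p₁ p₂) ∧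
      (∀ e : ℕ ≃ ℕ ⊕ Finset ℕ,
        HasSampleComplexity {membershipGraph e}
          (fun ε δ => C * (Real.log (1 / δ) / ε ^ 2)) ∧
        ∀ D : Set (Distinguisher ℕ 1), vcDim D < ⊤ → ∀ ε : ℝ, 0 < ε →
          ∃ p₁ p₂ : MeasureTheory.ProbabilityMeasure ℕ,
            IPM D p₁ p₂ < ε ∧ 1 / 2 ≤ IPM {membershipGraph e} p₁ p₂) := by
  have ⟨⟨g, hm, hg⟩, hmem⟩ := mainTheorem3_general ℕ
  exact ⟨1, one_pos, ⟨g, hm _, fun D hD ε hε ↦ hg D hD ε hε _ one_half_lt_one⟩,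
    fun e ↦ ⟨(hmem e).1 _, (hmem e).2⟩⟩
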